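/- Let $(X_t)_{t\in\mathbb R}$ be a real-valued Lévy process (with $X_0=0$, stationary independent increments and càdlàg paths; jumps of both signs are allowed), and let $K>0$. Let $(Q_t)_{t\ge 0}$ be the workload process obtained by reflecting $X$ from below at $0$ and from above at $K$ (finite buffer): $Q_t\in[0,K]$ and $$Q_t = Q_0 + X_t + R^-_t - R^+_t ,\qquad t\ge 0,$$ where $R^-$ and $R^+$ are non-decreasing, right-continuous, start at $0$ and satisfy $$\int_{(0,\infty)} Q_t\,{\rm d}R^-_t = \int_{(0,\infty)} (K-Q_t)\,{\rm d}R^+_t = 0 .$$ Assume that the workload is in stationarity at time $0$: $Q_0$ is independent of $(X_t)_{t\ge 0}$, and $Q_t$ has the same distribution as $Q_0$ for every $t\ge 0$. Assume also that ${\rm Var}\,Q_0>0$, so that the correlation function $$r(t) := \frac{{\rm Cov}(Q_0,Q_t)}{\sqrt{{\rm Var}\,Q_0\cdot{\rm Var}\,Q_t}},\qquad t\ge 0,$$ is well defined. Then $r(\cdot)$ is non-negative, non-increasing and convex on $[0,\infty)$. -/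

import Mathlib

open MeasureTheory ProbabilityTheory Filter Topology Set

/-- A path `x : ℝ → ℝ` is càdlàg: right-continuous, with a finite left limit at every point. -/
def IsCadlag (x : ℝ → ℝ) : Prop :=
  ∀ t, ContinuousWithinAt x (Ici t) t ∧ ∃ l : ℝ, Tendsto x (𝓝[<] t) (𝓝 l)

/-- A real-valued (two-sided) Lévy process `(X_t)_{t ∈ ℝ}` under `P`: it starts at `0` at time `0`,
has independent and stationary increments, and has càdlàg paths (almost surely). No restriction
is put on the jumps. -/
structure IsLevyProcess {Ω : Type*} [MeasurableSpace Ω] (X : ℝ → Ω → ℝ) (P : Measure Ω) :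
    Prop where
  measurable : ∀ t, Measurable (X t)
  zero : ∀ᵐ ω ∂P, X 0 ω = 0
  indep_increments : HasIndepIncrements X P
  stationary_increments : ∀ s t h : ℝ, s ≤ t →
    IdentDistrib (fun ω => X (t + h) ω - X (s + h) ω) (fun ω => X t ω - X s ω) P P
  cadlag : ∀ᵐ ω ∂P, IsCadlag (fun t => X t ω)

/-- The path `q` on `[0, ∞)` is the reflection of the driving path `x` (started from the
level `q 0`) from below at `0` and from above at `K`: `q` stays in `[0, K]` and
`q t = q 0 + x t + L t - U t` for regulators `L`, `U` that are non-decreasing and right-continuous,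
vanish at time `0`, and such that `L` only increases when `q` is at `0` and `U` only increases when
`q` is at `K`, i.e. `∫_{(0,∞)} q dL = ∫_{(0,∞)} (K - q) dU = 0`. -/
def IsDoublyReflected (K : ℝ) (x q : ℝ → ℝ) : Prop :=
  (∀ t, 0 ≤ t → q t ∈ Icc 0 K) ∧
  ∃ L U : StieltjesFunction ℝ,
    L 0 = 0 ∧ U 0 = 0 ∧
    (∀ t, 0 ≤ t → q t = q 0 + x t + L t - U t) ∧
    ∫⁻ t in Ioi (0 : ℝ), ENNReal.ofReal (q t) ∂L.measure = 0 ∧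
    ∫⁻ t in Ioi (0 : ℝ), ENNReal.ofReal (K - q t) ∂U.measure = 0

/-- The correlation coefficient `r(t)` of `Q_0` and `Q_t`. -/
noncomputable def workloadCorrelation {Ω : Type*} [MeasurableSpace Ω] (Q : ℝ → Ω → ℝ)
    (P : Measure Ω) (t : ℝ) : ℝ :=
  cov[Q 0, Q t; P] / √(Var[Q 0; P] * Var[Q t; P])

/-!
The workload after time `h` is a deterministic function of `Q h` and of the increments of the
driving process after `h`: on a uniform grid, the clamped random walk `reflectedWalk` started from
`Q h` converges pathwise to the doubly reflected path (`IsDoublyReflected.tendsto_reflectedWalk`),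
so that almost surely `Q (h + t) = φ_t (Q h, Y_h)` with `φ_t = reflectionMap K t` and `Y_h =
incrementsAfter X h`. Two features of `φ_t` are used: it is non-decreasing in the starting level,
and, being a limit of compositions of clamps, it is `1`-Lipschitz in it, so that `φ_t - φ_{t+s} =
φ_t - φ_s ∘ φ_t` is non-decreasing in the starting level as well.

By the Lévy property `Y_h` is independent of `(Q 0, Q h)` and distributed as `Y_0`. Write `c t =
E[Q 0 * Q t]`. Stationarity gives `c t = E[Q h * Q (h + t)]`, hence

* `c t - c (h + t) = E[(Q h - Q 0) * φ_t (Q h, Y_h)]`,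
* `(c t - c (h + t)) - (c (t + s) - c (h + t + s)) = E[(Q h - Q 0) * (φ_t - φ_{t+s}) (Q h, Y_h)]`.

Both are non-negative, since `E[(A - B) * g A] ≥ 0` whenever `A` and `B` have the same law and `g`
is non-decreasing: with `G` a (convex) primitive of `g`, `(A - B) * g A ≥ G A - G B`, and the
right-hand side has mean zero (`integral_sub_mul_nonneg_of_identDistrib`). Non-negativity of the
covariance is the same inequality with `B` replaced by the mean of `A`. A non-increasing function
whose increments over a fixed length are monotone is convex, which needs no continuity beforehand
(`convexOn_Ici_of_antitoneOn_of_second_difference`).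
-/

open scoped NNReal ENNReal

/-! ### The reflected random walk -/

/-- The projection of `y` onto `[0, K]` (for `0 ≤ K`). -/
def clamp (K y : ℝ) : ℝ := max 0 (min K y)

lemma clamp_mem_Icc {K : ℝ} (hK : 0 ≤ K) (y : ℝ) : clamp K y ∈ Icc 0 K :=
  ⟨le_max_left _ _, max_le hK (min_le_left _ _)⟩

lemma clamp_of_mem_Icc {K y : ℝ} (hy : y ∈ Icc 0 K) : clamp K y = y := by
  rw [clamp, min_eq_right hy.2, max_eq_right hy.1]

lemma clamp_mono (K : ℝ) : Monotone (clamp K) := fun _ _ h => by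
  unfold clamp; gcongr

lemma clamp_sub_le {K y z c : ℝ} (hc : 0 ≤ c) (h : z ≤ y + c) : clamp K z ≤ clamp K y + c := by
  unfold clamp; grind

lemma clamp_reflect {K : ℝ} (hK : 0 ≤ K) (y : ℝ) : clamp K (K - y) = K - clamp K y := by
  unfold clamp; grind

lemma measurable_clamp (K : ℝ) : Measurable (clamp K) := by
  unfold clamp; fun_prop

/-- The random walk with steps `δ`, started from `q` and projected onto `[0, K]` after every step
(and at the start): the discrete-time analogue of two-sided reflection. -/
def reflectedWalk (K q : ℝ) (δ : ℕ → ℝ) : ℕ → ℝ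
  | 0 => clamp K q
  | k + 1 => clamp K (reflectedWalk K q δ k + δ k)

lemma reflectedWalk_mem_Icc {K : ℝ} (hK : 0 ≤ K) (q : ℝ) (δ : ℕ → ℝ) (k : ℕ) :
    reflectedWalk K q δ k ∈ Icc 0 K := by
  cases k <;> exact clamp_mem_Icc hK _

lemma reflectedWalk_mono (K : ℝ) (δ : ℕ → ℝ) (k : ℕ) :
    Monotone fun q => reflectedWalk K q δ k := by
  intro q q' h
  induction k with
  | zero => exact clamp_mono K h
  | succ k ih => exact clamp_mono K (by simpa using ih)

lemma reflectedWalk_le_add (K : ℝ) (δ : ℕ → ℝ) (k : ℕ) {q q' : ℝ} (h : q ≤ q') :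
    reflectedWalk K q' δ k ≤ reflectedWalk K q δ k + (q' - q) := by
  induction k with
  | zero => exact clamp_sub_le (by linarith) (by linarith)
  | succ k ih => exact clamp_sub_le (by linarith) (by linarith)

/-- Exchanging the two barriers; it turns upper bounds for the walk into lower bounds. -/
lemma reflectedWalk_reflect {K : ℝ} (hK : 0 ≤ K) (q : ℝ) (δ : ℕ → ℝ) (k : ℕ) :
    reflectedWalk K (K - q) (fun i => -δ i) k = K - reflectedWalk K q δ k := by
  induction k with
  | zero => exact clamp_reflect hK q
  | succ k ih =>
    rw [reflectedWalk, reflectedWalk, ih, ← clamp_reflect hK]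
    congr 1; ring

lemma reflectedWalk_congr (K q : ℝ) {δ δ' : ℕ → ℝ} {n : ℕ} (h : ∀ k < n, δ k = δ' k) :
    reflectedWalk K q δ n = reflectedWalk K q δ' n := by
  induction n with
  | zero => rfl
  | succ n ih =>
    rw [reflectedWalk, reflectedWalk, ih fun k hk => h k (hk.trans (Nat.lt_succ_self n)),
      h n (Nat.lt_succ_self n)]

lemma measurable_reflectedWalk (K : ℝ) (k : ℕ) :
    Measurable fun p : ℝ × (ℕ → ℝ) => reflectedWalk K p.1 p.2 k := by
  induction k with
  | zero => exact (measurable_clamp K).comp measurable_fst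
  | succ k ih =>
    exact (measurable_clamp K).comp (ih.add ((measurable_pi_apply k).comp measurable_snd))

/-- Comparison of the walk with a sequence `v ≤ K` whose increments exceed `δ` by at most those of
the lower regulator `ℓ`: once `v` is below the walk up to `η`, it stays so up to the further
growth of `ℓ`. -/
lemma le_reflectedWalk_add {K q η : ℝ} {δ v ℓ : ℕ → ℝ} (hv : ∀ k, v k ≤ K) (hℓ : Monotone ℓ)
    (hstep : ∀ k, v (k + 1) ≤ v k + δ k + (ℓ (k + 1) - ℓ k)) (hη : 0 ≤ η) {j : ℕ}
    (hj : v j ≤ reflectedWalk K q δ j + η) {k : ℕ} (hk : j ≤ k) :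
    v k ≤ reflectedWalk K q δ k + η + (ℓ k - ℓ j) := by
  induction k, hk using Nat.le_induction with
  | base => simpa using hj
  | succ k hk ih =>
    have h1 := hstep k
    have h2 := hv (k + 1)
    have h3 := hℓ hk
    have h4 := hℓ (Nat.le_succ k)
    simp only [Nat.succ_eq_add_one] at h4
    rw [reflectedWalk]
    unfold clamp
    grind

/-- If the lower regulator `L` grows on `(a, b]`, then some time `v` in this interval has `q v`
small and almost no growth of `L` left after it. This bounds the lower integral from below by that
of a constant on a measurable set, so no measurability of `q` is required. -/
lemma exists_mem_Ioc_regulator {L : StieltjesFunction ℝ} {q : ℝ → ℝ} {a b ε : ℝ} (ha : 0 ≤ a)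
    (hL : ∫⁻ t in Ioi (0 : ℝ), ENNReal.ofReal (q t) ∂L.measure = 0) (hab : L a < L b)
    (hε : 0 < ε) : ∃ v ∈ Ioc a b, q v ≤ ε ∧ L b - L v ≤ ε := by
  by_contra! hcon
  have hlt : a < b := lt_of_not_ge fun h => absurd (L.mono h) (not_le.2 hab)
  set S : Set ℝ := Ioc a b ∩ {v | L b - L v ≤ ε} with hS
  have hSm : MeasurableSet S :=
    measurableSet_Ioc.inter (measurableSet_le (measurable_const.sub L.mono.measurable)
      measurable_const)
  have hS0 : S ⊆ Ioi 0 := fun v hv => lt_of_le_of_lt ha hv.1.1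
  have hpos : 0 < L.measure S := by
    rcases le_or_gt (L b - L a) ε with h | h
    · have : S = Ioc a b := by
        refine inter_eq_left.2 fun v hv => ?_
        have := L.mono hv.1.le
        simp only [mem_ofPred_eq]; linarith
      rw [this, L.measure_Ioc]
      simpa using hab
    -- `w` is the first time after which `L` grows by at most `ε`; an atom of `L` at `w` is possible
    · set T : Set ℝ := {v | a ≤ v ∧ L b - L v ≤ ε} with hT
      have hbT : b ∈ T := ⟨hlt.le, by simpa using hε.le⟩
      have hTb : BddBelow T := ⟨a, fun v hv => hv.1⟩
      set w := sInf T with hw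
      have haw : a ≤ w := le_csInf ⟨b, hbT⟩ fun v hv => hv.1
      have hwb : w ≤ b := csInf_le hTb hbT
      have hgt : ∀ v, w < v → L b - L v ≤ ε := fun v hv => by
        obtain ⟨u, hu, huv⟩ := exists_lt_of_csInf_lt ⟨b, hbT⟩ hv
        have := L.mono huv.le
        linarith [hu.2]
      have hwε : L b - L w ≤ ε := by
        have hc : Tendsto (fun v => L b - L v) (𝓝[>] w) (𝓝 (L b - L w)) :=
          tendsto_const_nhds.sub ((L.right_continuous w).mono_left
            (nhdsWithin_mono _ Ioi_subset_Ici_self))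
        exact le_of_tendsto hc (eventually_nhdsWithin_of_forall fun v hv => hgt v hv)
      have haw' : a < w := lt_of_le_of_ne haw fun h' => by rw [← h'] at hwε; linarith
      have hsub : Icc w b ⊆ S := fun v hv =>
        ⟨⟨haw'.trans_le hv.1, hv.2⟩, by
          have := L.mono hv.1
          simp only [mem_ofPred_eq]; linarith⟩
      refine lt_of_lt_of_le ?_ (measure_mono hsub)
      rw [L.measure_Icc, ENNReal.ofReal_pos]
      have : Function.leftLim L w ≤ L b - ε := by
        refine le_of_tendsto (L.mono.tendsto_leftLim w) ?_
        filter_upwards [Ioo_mem_nhdsLT haw'] with v hv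
        by_contra! hlt'
        exact absurd (csInf_le hTb (show v ∈ T from ⟨hv.1.le, by linarith⟩)) (not_le.2 hv.2)
      linarith
  have hle : ENNReal.ofReal ε * L.measure S ≤
      ∫⁻ t in Ioi (0 : ℝ), ENNReal.ofReal (q t) ∂L.measure := by
    calc ENNReal.ofReal ε * L.measure S = ∫⁻ _ in S, ENNReal.ofReal ε ∂L.measure := by simp
      _ ≤ ∫⁻ t in S, ENNReal.ofReal (q t) ∂L.measure := by
        refine setLIntegral_mono' hSm fun v hv => ENNReal.ofReal_le_ofReal ?_
        by_contra! hlt'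
        exact absurd (hcon v hv.1 hlt'.le) (not_lt.2 hv.2)
      _ ≤ _ := lintegral_mono_set hS0
  rw [hL, nonpos_iff_eq_zero, mul_eq_zero] at hle
  rcases hle with h | h
  · simp at h; linarith
  · exact hpos.ne' h

/-- Asymptotic upper bound of the reflected path by the walk on the uniform grid of `[a, a + t]`.
If the lower regulator is constant there, the path is below the walk at all grid points; otherwise
the comparison starts at a grid point shortly after a time at which the path is near `0` and the
lower regulator has almost stopped growing. -/
lemma eventually_le_reflectedWalk {K : ℝ} (hK : 0 ≤ K) {x q : ℝ → ℝ} {L U : StieltjesFunction ℝ}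
    (hx : ∀ s, 0 ≤ s → ContinuousWithinAt x (Ici s) s)
    (hmem : ∀ s, 0 ≤ s → q s ∈ Icc 0 K)
    (heq : ∀ s, 0 ≤ s → q s = q 0 + x s + L s - U s)
    (hL : ∫⁻ s in Ioi (0 : ℝ), ENNReal.ofReal (q s) ∂L.measure = 0)
    {a t ε : ℝ} (ha : 0 ≤ a) (ht : 0 ≤ t) (hε : 0 < ε) :
    ∀ᶠ n : ℕ in atTop, q (a + t) ≤ reflectedWalk K (q a)
      (fun k => x (a + t * ((k + 1) / (n + 1))) - x (a + t * (k / (n + 1)))) (n + 1) + ε := by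
  have hD0 : ∀ n k : ℕ, 0 ≤ a + t * (k / (n + 1) : ℝ) := fun n k => by positivity
  have hDm : ∀ n : ℕ, Monotone fun k : ℕ => a + t * (k / (n + 1) : ℝ) := fun n i j hij => by
    have : (i : ℝ) ≤ j := by exact_mod_cast hij
    dsimp only; gcongr
  have hend : ∀ n : ℕ, a + t * (((n + 1 : ℕ) : ℝ) / (n + 1)) = a + t := fun n => by
    push_cast; rw [div_self (by positivity), mul_one]
  -- the comparison between the `j`-th and the last grid point
  have key : ∀ (n j : ℕ) (η : ℝ), 0 ≤ η → j ≤ n + 1 →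
      q (a + t * (j / (n + 1) : ℝ)) ≤ reflectedWalk K (q a)
        (fun k => x (a + t * ((k + 1) / (n + 1))) - x (a + t * (k / (n + 1)))) j + η →
      q (a + t) ≤ reflectedWalk K (q a)
        (fun k => x (a + t * ((k + 1) / (n + 1))) - x (a + t * (k / (n + 1)))) (n + 1) + η +
          (L (a + t) - L (a + t * (j / (n + 1) : ℝ))) := fun n j η hη hj hqj => by
    have h := le_reflectedWalk_add (K := K) (q := q a) (η := η) (j := j) (k := n + 1)
      (δ := fun k => x (a + t * ((k + 1) / (n + 1))) - x (a + t * (k / (n + 1))))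
      (v := fun k : ℕ => q (a + t * (k / (n + 1) : ℝ)))
      (ℓ := fun k : ℕ => L (a + t * (k / (n + 1) : ℝ)))
      (fun k => (hmem _ (hD0 n k)).2) (L.mono.comp (hDm n)) (fun k => by
        have h1 := heq _ (hD0 n k)
        have h2 := heq _ (hD0 n (k + 1))
        have h3 := U.mono (hDm n (Nat.le_succ k))
        simp only [Nat.succ_eq_add_one] at h3
        push_cast at h2 h3 ⊢
        linarith) hη hqj hj
    simpa only [hend] using h
  rcases (L.mono (show a ≤ a + t by linarith)).lt_or_eq with hlt | hLeq
  · obtain ⟨v, ⟨hav, hvt⟩, hqv, hLv⟩ := exists_mem_Ioc_regulator ha hL hlt (half_pos (half_pos hε))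
    have hv0 : 0 ≤ v := ha.trans hav.le
    have htpos : 0 < t := by linarith
    have hqc : ContinuousWithinAt q (Ici v) v := by
      refine ContinuousWithinAt.congr (f := fun s => q 0 + x s + L s - U s) ?_
        (fun s hs => heq s (hv0.trans hs)) (heq v hv0)
      exact ((continuousWithinAt_const.add (hx v hv0)).add (L.right_continuous v)).sub
        (U.right_continuous v)
    have hev : ∀ᶠ s in 𝓝[≥] v, q s < ε / 2 := hqc.eventually_lt_const (by linarith)
    obtain ⟨w, hvw, hw⟩ := (mem_nhdsGE_iff_exists_Ico_subset).1 hev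
    have hmesh : Tendsto (fun n : ℕ => t * (1 / ((n : ℝ) + 1))) atTop (𝓝 0) := by
      simpa using (tendsto_one_div_add_atTop_nhds_zero_nat (𝕜 := ℝ)).const_mul t
    filter_upwards [hmesh.eventually_lt_const (sub_pos.2 (show v < w from hvw))] with n hn
    have hn1 : (0 : ℝ) < n + 1 := by positivity
    -- the first grid point at or after `v`; it lies in `[v, w)` since the mesh is below `w - v`
    set j := ⌈(v - a) / t * (n + 1)⌉₊ with hjdef
    have hj1 : (v - a) / t * (n + 1) ≤ j := Nat.le_ceil _
    have hj2 : (j : ℝ) < (v - a) / t * (n + 1) + 1 :=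
      Nat.ceil_lt_add_one (mul_nonneg (div_nonneg (by linarith) ht) hn1.le)
    have hjn : j ≤ n + 1 := by
      refine Nat.ceil_le.2 ?_
      push_cast
      refine mul_le_of_le_one_left hn1.le ((div_le_one htpos).2 (by linarith))
    have e1 : v ≤ a + t * (j / (n + 1)) := by
      have : (v - a) / t ≤ j / (n + 1) := (le_div_iff₀ hn1).2 hj1
      have := (div_le_iff₀ htpos).1 this
      linarith
    have e2 : a + t * (j / (n + 1)) < w := by
      have h1 : (j : ℝ) / (n + 1) < (v - a) / t + 1 / (n + 1) := by
        rw [div_lt_iff₀ hn1, add_mul, one_div_mul_cancel hn1.ne']; exact hj2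
      have h2 := mul_lt_mul_of_pos_left h1 htpos
      rw [mul_add, mul_div_cancel₀ _ htpos.ne'] at h2
      linarith
    have hq : q (a + t * (j / (n + 1))) < ε / 2 := hw ⟨e1, e2⟩
    have := key n j (ε / 2) (half_pos hε).le hjn
      (by linarith [(reflectedWalk_mem_Icc hK (q a) (fun k =>
        x (a + t * ((k + 1) / (n + 1))) - x (a + t * (k / (n + 1)))) j).1])
    have hLm := L.mono e1
    linarith
  · refine Eventually.of_forall fun n => ?_
    have := key n 0 0 le_rfl (Nat.zero_le _) (by
      simp only [Nat.cast_zero, zero_div, mul_zero, add_zero, reflectedWalk]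
      rw [clamp_of_mem_Icc (hmem a ha)])
    simp only [Nat.cast_zero, zero_div, mul_zero, add_zero, ← hLeq, sub_self] at this
    linarith

/-- A doubly reflected càdlàg path is the limit of the clamped random walks driven by the
increments of `x` over uniform grids. The regulators no longer appear, so this also yields
uniqueness. -/
lemma IsDoublyReflected.tendsto_reflectedWalk {K : ℝ} (hK : 0 ≤ K) {x q : ℝ → ℝ}
    (hx : IsCadlag x) (h : IsDoublyReflected K x q) {a t : ℝ} (ha : 0 ≤ a) (ht : 0 ≤ t) :
    Tendsto (fun n : ℕ => reflectedWalk K (q a)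
      (fun k => x (a + t * ((k + 1) / (n + 1))) - x (a + t * (k / (n + 1)))) (n + 1))
      atTop (𝓝 (q (a + t))) := by
  obtain ⟨hmem, L, U, -, -, heq, hL, hU⟩ := h
  refine Metric.tendsto_nhds.2 fun ε hε => ?_
  have h1 := eventually_le_reflectedWalk hK (fun s _ => (hx s).1) hmem heq hL ha ht (half_pos hε)
  -- the lower bound: `K - q` is the reflection of `-x`, with the regulators exchanged
  have h2 := eventually_le_reflectedWalk (x := fun s => -x s) (q := fun s => K - q s) (L := U)
    (U := L) hK (fun s _ => (hx s).1.neg)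
    (fun s hs => ⟨by linarith [(hmem s hs).2], by linarith [(hmem s hs).1]⟩)
    (fun s hs => by rw [heq s hs]; ring) hU ha ht (half_pos hε)
  filter_upwards [h1, h2] with n h1 h2
  have e := reflectedWalk_reflect hK (q a)
    (fun k : ℕ => x (a + t * ((k + 1) / (n + 1))) - x (a + t * (k / (n + 1)))) (n + 1)
  simp only [neg_sub] at e
  simp only [neg_sub_neg] at h2
  rw [e] at h2
  rw [Real.dist_eq, abs_lt]
  constructor <;> linarith

/-- The `k`-th increment of `y` over the uniform grid of `[0, t]` with `n + 1` cells. -/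
noncomputable def gridIncrement (y : ℝ≥0 → ℝ) (t : ℝ≥0) (n k : ℕ) : ℝ :=
  y (t * ((k + 1) / (n + 1))) - y (t * (k / (n + 1)))

/-- The level at time `t` of the reflection in `[0, K]` of the path `y`, started from `q`, as a
limit of reflected walks. The upper limit makes it defined for every `y : ℝ≥0 → ℝ`, and jointly
measurable in `(q, y)` for the product σ-algebra; for doubly reflected càdlàg paths the limit
exists. -/
noncomputable def reflectionMap (K : ℝ) (t : ℝ≥0) (q : ℝ) (y : ℝ≥0 → ℝ) : ℝ :=
  limsup (fun n : ℕ => reflectedWalk K q (gridIncrement y t n) (n + 1)) atTop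

lemma isBoundedUnder_le_reflectedWalk {K : ℝ} (hK : 0 ≤ K) (t : ℝ≥0) (q : ℝ) (y : ℝ≥0 → ℝ) :
    IsBoundedUnder (· ≤ ·) atTop
      (fun n : ℕ => reflectedWalk K q (gridIncrement y t n) (n + 1)) :=
  isBoundedUnder_of ⟨K, fun _ => (reflectedWalk_mem_Icc hK _ _ _).2⟩

lemma isCoboundedUnder_le_reflectedWalk {K : ℝ} (hK : 0 ≤ K) (t : ℝ≥0) (q : ℝ) (y : ℝ≥0 → ℝ) :
    IsCoboundedUnder (· ≤ ·) atTop
      (fun n : ℕ => reflectedWalk K q (gridIncrement y t n) (n + 1)) :=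
  (isBoundedUnder_of ⟨0, fun _ => (reflectedWalk_mem_Icc hK _ _ _).1⟩ :
    IsBoundedUnder (· ≥ ·) atTop _).isCoboundedUnder_le

lemma reflectionMap_mem_Icc {K : ℝ} (hK : 0 ≤ K) (t : ℝ≥0) (q : ℝ) (y : ℝ≥0 → ℝ) :
    reflectionMap K t q y ∈ Icc 0 K :=
  ⟨le_limsup_of_le (isBoundedUnder_le_reflectedWalk hK t q y) fun _ h =>
      (reflectedWalk_mem_Icc hK _ _ _).1.trans h.exists.choose_spec,
    limsup_le_of_le (isCoboundedUnder_le_reflectedWalk hK t q y)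
      (Eventually.of_forall fun _ => (reflectedWalk_mem_Icc hK _ _ _).2)⟩

lemma reflectionMap_mono {K : ℝ} (hK : 0 ≤ K) (t : ℝ≥0) (y : ℝ≥0 → ℝ) :
    Monotone fun q => reflectionMap K t q y := fun q q' h =>
  limsup_le_limsup (Eventually.of_forall fun _ => reflectedWalk_mono K _ _ h)
    (isCoboundedUnder_le_reflectedWalk hK t q y) (isBoundedUnder_le_reflectedWalk hK t q' y)

lemma reflectionMap_le_add {K : ℝ} (hK : 0 ≤ K) (t : ℝ≥0) (y : ℝ≥0 → ℝ) {q q' : ℝ}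
    (h : q ≤ q') : reflectionMap K t q' y ≤ reflectionMap K t q y + (q' - q) := by
  unfold reflectionMap
  rw [← limsup_add_const atTop _ (q' - q) (isBoundedUnder_le_reflectedWalk hK t q y)
    (isCoboundedUnder_le_reflectedWalk hK t q y)]
  refine limsup_le_limsup (Eventually.of_forall fun _ => reflectedWalk_le_add K _ _ h)
    (isCoboundedUnder_le_reflectedWalk hK t q' y)
    (isBoundedUnder_of ⟨K + (q' - q), fun n => ?_⟩)
  linarith [(reflectedWalk_mem_Icc hK q (gridIncrement y t n) (n + 1)).2]

lemma abs_reflectionMap_le (hK : 0 ≤ K) (t : ℝ≥0) (q : ℝ) (y : ℝ≥0 → ℝ) :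
    |reflectionMap K t q y| ≤ K := by
  have := reflectionMap_mem_Icc hK t q y
  rw [abs_of_nonneg this.1]; exact this.2

/-- The level at time `t` only depends on the driving path up to time `t`. -/
lemma reflectionMap_stopped (K : ℝ) (t : ℝ≥0) (q : ℝ) (y : ℝ≥0 → ℝ) :
    reflectionMap K t q (fun u => y (min u t)) = reflectionMap K t q y := by
  unfold reflectionMap
  congr 1
  funext n
  refine reflectedWalk_congr K q fun k hk => ?_
  have hk' : (k : ℝ≥0) + 1 ≤ n + 1 := by exact_mod_cast hk
  have h1 : t * ((k + 1) / (n + 1)) ≤ t := mul_le_of_le_one_right' (div_le_one_of_le₀ hk' bot_le)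
  have h2 : t * (k / (n + 1)) ≤ t :=
    mul_le_of_le_one_right' (div_le_one_of_le₀ (le_self_add.trans hk') bot_le)
  simp only [gridIncrement, min_eq_left h1, min_eq_left h2]

lemma measurable_reflectionMap (K : ℝ) (t : ℝ≥0) :
    Measurable fun p : ℝ × (ℝ≥0 → ℝ) => reflectionMap K t p.1 p.2 := by
  refine Measurable.limsup fun n => ?_
  refine (measurable_reflectedWalk K (n + 1)).comp (measurable_fst.prodMk ?_)
  refine measurable_pi_lambda _ fun k => ?_
  exact ((measurable_pi_apply _).comp measurable_snd).sub
    ((measurable_pi_apply _).comp measurable_snd)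

lemma IsDoublyReflected.eq_reflectionMap {K : ℝ} (hK : 0 ≤ K) {x q : ℝ → ℝ}
    (hx : IsCadlag x) (h : IsDoublyReflected K x q) (a t : ℝ≥0) :
    q ((a + t : ℝ≥0) : ℝ) = reflectionMap K t (q a) (fun u => x ((a + u : ℝ≥0) : ℝ) - x a) := by
  refine ((h.tendsto_reflectedWalk hK hx a.2 t.2).congr fun n => ?_).limsup_eq.symm
  congr 1
  funext k
  simp [gridIncrement]

/-! ### Increments of a Lévy process -/

/-- If `A` is independent of `Z`, and the past `p Z` of `Z` is independent of its future `f Z`, then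
`(A, p Z)` is independent of `f Z`. -/
lemma indepFun_prodMk_of_indepFun_comp {Ω α β γ δ : Type*} [MeasurableSpace Ω] [MeasurableSpace α]
    [MeasurableSpace β] [MeasurableSpace γ] [MeasurableSpace δ] {P : Measure Ω}
    [IsProbabilityMeasure P] {A : Ω → α} {Z : Ω → β} {p : β → γ} {f : β → δ}
    (hA : AEMeasurable A P) (hZ : Measurable Z) (hp : Measurable p) (hf : Measurable f)
    (hAZ : IndepFun A Z P) (hpf : IndepFun (p ∘ Z) (f ∘ Z) P) :
    IndepFun (fun ω => (A ω, p (Z ω))) (fun ω => f (Z ω)) P := by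
  have hpZ : Measurable fun ω => p (Z ω) := hp.comp hZ
  have hfZ : Measurable fun ω => f (Z ω) := hf.comp hZ
  have h1 := (indepFun_iff_map_prod_eq_prod_map_map hA (hpZ.prodMk hfZ).aemeasurable).1
    (hAZ.comp measurable_id (hp.prodMk hf))
  have h2 := (indepFun_iff_map_prod_eq_prod_map_map hpZ.aemeasurable hfZ.aemeasurable).1 hpf
  have h3 := (indepFun_iff_map_prod_eq_prod_map_map hA hpZ.aemeasurable).1
    (hAZ.comp measurable_id hp)
  refine (indepFun_iff_map_prod_eq_prod_map_map (hA.prodMk hpZ.aemeasurable)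
    hfZ.aemeasurable).2 ?_
  have hA3 : AEMeasurable (fun ω => (A ω, (p (Z ω), f (Z ω)))) P :=
    hA.prodMk (hpZ.prodMk hfZ).aemeasurable
  have e : P.map (fun ω => ((A ω, p (Z ω)), f (Z ω))) =
      (P.map fun ω => (A ω, (p (Z ω), f (Z ω)))).map MeasurableEquiv.prodAssoc.symm := by
    rw [AEMeasurable.map_map_of_aemeasurable (MeasurableEquiv.measurable _).aemeasurable hA3]
    rfl
  rw [e, h1, h2, h3, ← Measure.prodAssoc_prod,
    Measure.map_map (MeasurableEquiv.measurable _) (MeasurableEquiv.measurable _)]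
  simp

lemma exists_monotone_enumeration (S : Finset ℝ≥0) :
    ∃ τ : ℕ → ℝ≥0, Monotone τ ∧ τ 0 = 0 ∧ ∀ u ∈ S, ∃ k, τ k = u := by
  classical
  set T := insert 0 S with hT
  have hc : 0 < T.card := Finset.card_pos.2 ⟨0, Finset.mem_insert_self _ _⟩
  let τ : ℕ → ℝ≥0 := fun k => T.orderEmbOfFin rfl ⟨min k (T.card - 1), by omega⟩
  have hm : Monotone τ := fun i j hij =>
    (T.orderEmbOfFin rfl).monotone (by simp only [Fin.mk_le_mk]; omega)
  have hr : ∀ u ∈ T, ∃ k, τ k = u := fun u hu => by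
    rw [← Finset.mem_coe, ← Finset.range_orderEmbOfFin T rfl] at hu
    obtain ⟨i, rfl⟩ := hu
    exact ⟨i, by simp only [τ]; congr 2; have := i.2; omega⟩
  refine ⟨τ, hm, ?_, fun u hu => hr u (Finset.mem_insert_of_mem hu)⟩
  obtain ⟨k, hk⟩ := hr 0 (Finset.mem_insert_self _ _)
  exact le_antisymm (hk ▸ hm (Nat.zero_le k)) bot_le

section LevyIncrements

variable {Ω : Type*} [MeasurableSpace Ω] {P : Measure Ω} {X : ℝ → Ω → ℝ}

/-- The increments `u ↦ X (h + u) - X h` of the process after time `h`, as a random path. -/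
def incrementsAfter (X : ℝ → Ω → ℝ) (h : ℝ≥0) (ω : Ω) (u : ℝ≥0) : ℝ :=
  X ((h + u : ℝ≥0) : ℝ) ω - X h ω

lemma measurable_incrementsAfter (hX : ∀ t, Measurable (X t)) (h : ℝ≥0) :
    Measurable (incrementsAfter X h) :=
  measurable_pi_lambda _ fun _ => (hX _).sub (hX _)

lemma IsLevyProcess.identDistrib_incrementsAfter [IsProbabilityMeasure P]
    (hX : IsLevyProcess X P) (h : ℝ≥0) :
    IdentDistrib (incrementsAfter X h) (incrementsAfter X 0) P P := by
  refine (identDistrib_iff_forall_finset_identDistrib (𝓧 := fun _ : ℝ≥0 => ℝ)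
    (X := fun u ω => incrementsAfter X h ω u) (Y := fun u ω => incrementsAfter X 0 ω u)
    (measurable_incrementsAfter hX.measurable h).aemeasurable
    (measurable_incrementsAfter hX.measurable 0).aemeasurable).2 fun I => ?_
  obtain ⟨τ, hτ, hτ0, hτI⟩ := exists_monotone_enumeration I
  choose! idx hidx using hτI
  let ξ : ℝ≥0 → ℕ → Ω → ℝ := fun a k ω =>
    X ((a + τ (k + 1) : ℝ≥0) : ℝ) ω - X ((a + τ k : ℝ≥0) : ℝ) ω
  have hξm : ∀ a k, Measurable (ξ a k) := fun a k => (hX.measurable _).sub (hX.measurable _)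
  have hξi : ∀ a, iIndepFun (ξ a) P := fun a =>
    hX.indep_increments.nat (t := fun k => ((a + τ k : ℝ≥0) : ℝ)) fun i j hij => by
      have := hτ hij
      dsimp only; gcongr
  have hξ : IdentDistrib (fun ω k => ξ h k ω) (fun ω k => ξ 0 k ω) P P := by
    refine ⟨(measurable_pi_lambda _ (hξm h)).aemeasurable,
      (measurable_pi_lambda _ (hξm 0)).aemeasurable, ?_⟩
    rw [(hξi h).map_fun_eq_infinitePi_map (hξm h), (hξi 0).map_fun_eq_infinitePi_map (hξm 0)]
    congr 1
    funext k
    have := (hX.stationary_increments (τ k) (τ (k + 1)) h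
      (by exact_mod_cast hτ (Nat.le_succ k))).map_eq
    simpa [ξ, add_comm] using this
  let φ : (ℕ → ℝ) → I → ℝ := fun z i => ∑ k ∈ Finset.range (idx i), z k
  have hφ : Measurable φ := measurable_pi_lambda _ fun i =>
    Finset.measurable_sum _ fun k _ => measurable_pi_apply k
  have hsum : ∀ a, φ ∘ (fun ω k => ξ a k ω) = fun ω => I.restrict (incrementsAfter X a ω) :=
    fun a => by
      funext ω i
      simp only [φ, ξ, Function.comp_apply, Finset.restrict_def, incrementsAfter]
      rw [Finset.sum_range_sub (fun k => X ((a + τ k : ℝ≥0) : ℝ) ω), hidx i i.2, hτ0, add_zero]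
  have := hξ.comp hφ
  rwa [hsum, hsum] at this

lemma IsLevyProcess.indepFun_past_future [IsProbabilityMeasure P]
    (hX : IsLevyProcess X P) (h : ℝ≥0) :
    IndepFun (fun ω (u : ℝ≥0) => incrementsAfter X 0 ω (min u h)) (incrementsAfter X h) P := by
  classical
  refine IndepFun.process_indepFun_process (𝓧 := fun _ : ℝ≥0 => ℝ) (𝓨 := fun _ : ℝ≥0 => ℝ)
    (X := fun u ω => incrementsAfter X 0 ω (min u h)) (Y := fun u ω => incrementsAfter X h ω u)
    (fun u => (hX.measurable _).sub (hX.measurable _))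
    (fun u => (hX.measurable _).sub (hX.measurable _)) fun I J => ?_
  -- a single time grid through `h` contains all the past and future times considered
  obtain ⟨τ, hτ, hτ0, hcov⟩ := exists_monotone_enumeration
    (insert h (I.image (fun u => min u h) ∪ J.image (fun u => h + u)))
  obtain ⟨m, hm⟩ := hcov h (by simp)
  -- the index is chosen at most `m` for past times and at least `m` for future ones, which matters
  -- as `τ` need not be injective
  have hI : ∀ u ∈ I, ∃ k ≤ m, τ k = min u h := fun u hu => by
    obtain ⟨k, hk⟩ := hcov (min u h) (Finset.mem_insert_of_mem
      (Finset.mem_union_left _ (Finset.mem_image_of_mem _ hu)))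
    rcases le_total k m with hkm | hkm
    · exact ⟨k, hkm, hk⟩
    · exact ⟨m, le_rfl, le_antisymm ((hτ hkm).trans hk.le) (hm ▸ min_le_right _ _)⟩
  have hJ : ∀ u ∈ J, ∃ k, m ≤ k ∧ τ k = h + u := fun u hu => by
    obtain ⟨k, hk⟩ := hcov (h + u) (Finset.mem_insert_of_mem
      (Finset.mem_union_right _ (Finset.mem_image_of_mem _ hu)))
    rcases le_total k m with hkm | hkm
    · exact ⟨m, le_rfl, le_antisymm (hm ▸ le_self_add) (hk ▸ hτ hkm)⟩
    · exact ⟨k, hkm, hk⟩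
  choose! α hαm hα using hI
  choose! β hmβ hβ using hJ
  let ξ : ℕ → Ω → ℝ := fun k ω => X (τ (k + 1)) ω - X (τ k) ω
  have hξi : iIndepFun ξ P := hX.indep_increments.nat (t := fun k => (τ k : ℝ)) fun i j hij =>
    NNReal.coe_le_coe.2 (hτ hij)
  set M := J.sup β
  have hdis : Disjoint (Finset.range m) (Finset.Ico m M) :=
    Finset.disjoint_left.2 fun k hk hk' => by
      simp only [Finset.mem_range, Finset.mem_Ico] at hk hk'; omega
  have hind := hξi.indepFun_finset (Finset.range m) (Finset.Ico m M) hdis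
    fun k => (hX.measurable _).sub (hX.measurable _)
  let φ : (Finset.range m → ℝ) → I → ℝ := fun z i =>
    ∑ k : Finset.range m, if (k : ℕ) < α i then z k else 0
  let ψ : (Finset.Ico m M → ℝ) → J → ℝ := fun z j =>
    ∑ k : Finset.Ico m M, if (k : ℕ) < β j then z k else 0
  have hφ : Measurable φ := measurable_pi_lambda _ fun i =>
    Finset.measurable_sum _ fun k _ => by split_ifs <;> fun_prop
  have hψ : Measurable ψ := measurable_pi_lambda _ fun j =>
    Finset.measurable_sum _ fun k _ => by split_ifs <;> fun_prop
  have := hind.comp hφ hψ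
  convert this using 1
  · funext ω i
    simp only [φ, ξ, Function.comp_apply]
    rw [Finset.sum_coe_sort (Finset.range m)
      (fun k => if k < α i then X (τ (k + 1)) ω - X (τ k) ω else 0), ← Finset.sum_filter]
    have : (Finset.range m).filter (· < α i) = Finset.range (α i) := by
      ext k; have := hαm i i.2; simp only [Finset.mem_filter, Finset.mem_range]; omega
    rw [this, Finset.sum_range_sub (fun k => X (τ k) ω), hα i i.2, hτ0]
    simp [incrementsAfter]
  · funext ω j
    simp only [ψ, ξ, Function.comp_apply]
    rw [Finset.sum_coe_sort (Finset.Ico m M)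
      (fun k => if k < β j then X (τ (k + 1)) ω - X (τ k) ω else 0), ← Finset.sum_filter]
    have : (Finset.Ico m M).filter (· < β j) = Finset.Ico m (β j) := by
      ext k
      have : β j ≤ M := Finset.le_sup j.2
      simp only [Finset.mem_filter, Finset.mem_Ico]; omega
    rw [this, Finset.sum_Ico_sub (fun k => X (τ k) ω) (hmβ j j.2), hβ j j.2, hm]
    rfl

end LevyIncrements

/-! ### Expectations of products with monotone functions -/

section MonotoneIntegrals

variable {Ω : Type*} [MeasurableSpace Ω] {P : Measure Ω}

/-- An inequality `E[(A - B) * g A] ≥ 0` valid for all bounded non-decreasing `g` extends to random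
non-decreasing functions `H (·, Y)` independent of `(A, B)`, by conditioning on `Y`. -/
lemma integral_sub_mul_nonneg_of_indepFun [IsProbabilityMeasure P] {E : Type*} [MeasurableSpace E]
    {A B : Ω → ℝ} {Y : Ω → E} {H : ℝ × E → ℝ} {C K : ℝ}
    (hA : AEMeasurable A P) (hB : AEMeasurable B P) (hY : Measurable Y) (hH : Measurable H)
    (hAK : ∀ᵐ ω ∂P, A ω ∈ Icc 0 K) (hBK : ∀ᵐ ω ∂P, B ω ∈ Icc 0 K)
    (hind : IndepFun (fun ω => (A ω, B ω)) Y P)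
    (hHC : ∀ p, |H p| ≤ C) (hHm : ∀ y, Monotone fun a => H (a, y))
    (hAB : ∀ g : ℝ → ℝ, Monotone g → (∀ a, |g a| ≤ C) → 0 ≤ ∫ ω, (A ω - B ω) * g (A ω) ∂P) :
    0 ≤ ∫ ω, (A ω - B ω) * H (A ω, Y ω) ∂P := by
  have hABm : AEMeasurable (fun ω => (A ω, B ω)) P := hA.prodMk hB
  have hF : Measurable fun p : (ℝ × ℝ) × E => (p.1.1 - p.1.2) * H (p.1.1, p.2) := by fun_prop
  have hmap := (indepFun_iff_map_prod_eq_prod_map_map hABm hY.aemeasurable).1 hind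
  have hint : Integrable (fun ω => (A ω - B ω) * H (A ω, Y ω)) P := by
    refine Integrable.of_bound (hF.comp_aemeasurable
      (hABm.prodMk hY.aemeasurable)).aestronglyMeasurable (K * C) ?_
    filter_upwards [hAK, hBK] with ω h1 h2
    rw [Real.norm_eq_abs, abs_mul]
    exact mul_le_mul (abs_le.2 ⟨by linarith [h1.1, h2.2], by linarith [h1.2, h2.1]⟩) (hHC _)
      (abs_nonneg _) (h1.1.trans h1.2)
  have e : ∫ ω, (A ω - B ω) * H (A ω, Y ω) ∂P = ∫ p, (p.1.1 - p.1.2) * H (p.1.1, p.2)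
      ∂((P.map fun ω => (A ω, B ω)).prod (P.map Y)) := by
    rw [← hmap, integral_map (hABm.prodMk hY.aemeasurable) hF.aestronglyMeasurable]
  have hint' : Integrable (fun p : (ℝ × ℝ) × E => (p.1.1 - p.1.2) * H (p.1.1, p.2))
      ((P.map fun ω => (A ω, B ω)).prod (P.map Y)) := by
    rw [← hmap]
    exact (integrable_map_measure hF.aestronglyMeasurable (hABm.prodMk hY.aemeasurable)).2 hint
  have : IsProbabilityMeasure (P.map fun ω => (A ω, B ω)) := Measure.isProbabilityMeasure_map hABm
  have : IsProbabilityMeasure (P.map Y) := Measure.isProbabilityMeasure_map hY.aemeasurable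
  rw [e, integral_prod_symm _ hint']
  refine integral_nonneg fun y => ?_
  dsimp only
  rw [integral_map hABm (by fun_prop)]
  exact hAB (fun a => H (a, y)) (hHm y) fun a => hHC _

/-- Among the couplings of two copies of a law, the comonotone one maximises `E[B * g A]`. The proof
uses the subgradient inequality for a primitive `G` of `g`. -/
lemma integral_sub_mul_nonneg_of_identDistrib [IsProbabilityMeasure P] {A B : Ω → ℝ} {K : ℝ}
    (hAB : IdentDistrib A B P P) (hAK : ∀ᵐ ω ∂P, A ω ∈ Icc 0 K) (hBK : ∀ᵐ ω ∂P, B ω ∈ Icc 0 K)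
    {g : ℝ → ℝ} {C : ℝ} (hg : Monotone g) (hgC : ∀ a, |g a| ≤ C) :
    0 ≤ ∫ ω, (A ω - B ω) * g (A ω) ∂P := by
  set G : ℝ → ℝ := fun x => ∫ u in (0 : ℝ)..x, g u with hG
  have hgi : ∀ a b, IntervalIntegrable g volume a b := fun a b => hg.intervalIntegrable
  have hGc : Continuous G := intervalIntegral.continuous_primitive hgi 0
  have hsub : ∀ a b, G a - G b ≤ (a - b) * g a := fun a b => by
    have e : G a - G b = ∫ u in b..a, g u :=
      intervalIntegral.integral_interval_sub_left (hgi 0 a) (hgi 0 b)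
    rw [e]
    rcases le_total b a with hba | hab
    · calc ∫ u in b..a, g u ≤ ∫ _ in b..a, g a :=
            intervalIntegral.integral_mono_on hba (hgi _ _) (by simp) fun u hu => hg hu.2
        _ = (a - b) * g a := by simp
    · rw [intervalIntegral.integral_symm]
      have : (b - a) * g a ≤ ∫ u in a..b, g u := by
        calc (b - a) * g a = ∫ _ in a..b, g a := by simp
          _ ≤ _ := intervalIntegral.integral_mono_on hab (by simp) (hgi _ _) fun u hu => hg hu.1
      linarith
  have hGb : ∃ D, ∀ x ∈ Icc 0 K, ‖G x‖ ≤ D :=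
    isCompact_Icc.exists_bound_of_continuousOn hGc.continuousOn
  obtain ⟨D, hD⟩ := hGb
  have hGA : Integrable (fun ω => G (A ω)) P :=
    Integrable.of_bound (hGc.measurable.comp_aemeasurable
      hAB.aemeasurable_fst).aestronglyMeasurable D (hAK.mono fun ω h => hD _ h)
  have hGB : Integrable (fun ω => G (B ω)) P :=
    Integrable.of_bound (hGc.measurable.comp_aemeasurable
      hAB.aemeasurable_snd).aestronglyMeasurable D (hBK.mono fun ω h => hD _ h)
  have heq : ∫ ω, G (A ω) ∂P = ∫ ω, G (B ω) ∂P := (hAB.comp hGc.measurable).integral_eq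
  have hint : Integrable (fun ω => (A ω - B ω) * g (A ω)) P := by
    refine Integrable.of_bound (((hAB.aemeasurable_fst.sub hAB.aemeasurable_snd).mul
      (hg.measurable.comp_aemeasurable hAB.aemeasurable_fst)).aestronglyMeasurable) (K * C) ?_
    filter_upwards [hAK, hBK] with ω h1 h2
    rw [Real.norm_eq_abs, abs_mul]
    exact mul_le_mul (abs_le.2 ⟨by linarith [h1.1, h2.2], by linarith [h1.2, h2.1]⟩) (hgC _)
      (abs_nonneg _) (h1.1.trans h1.2)
  calc (0 : ℝ) = ∫ ω, (G (A ω) - G (B ω)) ∂P := by rw [integral_sub hGA hGB, heq, sub_self]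
    _ ≤ _ := integral_mono (hGA.sub hGB) hint fun ω => hsub _ _

/-- Chebyshev's association inequality: `A` and a non-decreasing function of `A` are non-negatively
correlated. -/
lemma integral_sub_integral_mul_nonneg [IsProbabilityMeasure P] {A : Ω → ℝ} {K : ℝ}
    (hA : AEMeasurable A P) (hAK : ∀ᵐ ω ∂P, A ω ∈ Icc 0 K)
    {g : ℝ → ℝ} {C : ℝ} (hg : Monotone g) (hgC : ∀ a, |g a| ≤ C) :
    0 ≤ ∫ ω, (A ω - ∫ ω', A ω' ∂P) * g (A ω) ∂P := by
  set m := ∫ ω', A ω' ∂P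
  have hAi : Integrable A P := Integrable.of_mem_Icc 0 K hA hAK
  have hint : Integrable (fun ω => (A ω - m) * g (A ω)) P :=
    (hAi.sub (integrable_const m)).mul_bdd (c := C)
      (hg.measurable.comp_aemeasurable hA).aestronglyMeasurable
      (Eventually.of_forall fun ω => hgC _)
  have h0 : ∫ ω, (A ω - m) * g m ∂P = 0 := by
    rw [integral_mul_const, integral_sub hAi (integrable_const m)]
    simp [m]
  rw [← h0]
  refine integral_mono ((hAi.sub (integrable_const m)).mul_const _) hint fun ω => ?_
  rcases le_total m (A ω) with h | h
  · exact mul_le_mul_of_nonneg_left (hg h) (sub_nonneg.2 h)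
  · exact mul_le_mul_of_nonpos_left (hg h) (sub_nonpos.2 h)

end MonotoneIntegrals

/-! ### Convexity from second differences -/

/-- A non-increasing function on `[0, ∞)` whose decrements over intervals of a fixed length are
non-increasing in the position is convex. -/
lemma convexOn_Ici_of_antitoneOn_of_second_difference {f : ℝ → ℝ} (hf : AntitoneOn f (Ici 0))
    (h2 : ∀ t d s, 0 ≤ t → 0 ≤ d → 0 ≤ s → f (t + s) - f (t + s + d) ≤ f t - f (t + d)) :
    ConvexOn ℝ (Ici 0) f := by
  refine convexOn_of_slope_mono_adjacent (convex_Ici 0) fun {x y z} hx hz hxy hyz => ?_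
  have hx0 : 0 ≤ x := hx
  have hy0 : 0 ≤ y := hx0.trans hxy.le
  set a := y - x with ha
  have hapos : 0 < a := sub_pos.2 hxy
  have hxy' : 0 ≤ f x - f y := sub_nonneg.2 (hf hx hy0 hxy.le)
  -- with mesh `d = a / (n + 1)`, each decrement to the left of `y` is at least `f y - f (y + d)` and
  -- each one to the right is at most that; about `(z - y) / d` of them cover `[y, z]`
  have key : ∀ n : ℕ, f y - f z ≤ ((z - y) / a + 1 / ((n : ℝ) + 1)) * (f x - f y) := fun n => by
    have hn : (0 : ℝ) < n + 1 := by positivity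
    set d := a / (n + 1) with hd
    have hdpos : 0 < d := by positivity
    have hleft : (n + 1) * (f y - f (y + d)) ≤ f x - f y := by
      have : ∀ k : ℕ, k ≤ n + 1 → k * (f y - f (y + d)) ≤ f x - f (x + k * d) := fun k => by
        induction k with
        | zero => simp
        | succ k ih =>
          intro hk
          have hkd : (k + 1 : ℝ) * d ≤ a := by
            rw [hd, mul_div_assoc', div_le_iff₀ hn, mul_comm]
            gcongr
            exact_mod_cast (by omega : k ≤ n)
          have h1 := ih (by omega)
          have h3 := h2 (x + k * d) d (y - (x + k * d)) (by positivity) hdpos.le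
            (by linarith)
          rw [add_sub_cancel] at h3
          push_cast
          rw [show x + (k + 1 : ℝ) * d = x + k * d + d by ring]
          linarith
      have h := this (n + 1) le_rfl
      have e : x + ((n + 1 : ℕ) : ℝ) * d = y := by
        push_cast; rw [hd, mul_div_cancel₀ _ hn.ne', ha]; ring
      rw [e] at h
      exact_mod_cast h
    have hright : ∀ k : ℕ, f y - f (y + k * d) ≤ k * (f y - f (y + d)) := fun k => by
      induction k with
      | zero => simp
      | succ k ih =>
        have h3 := h2 y d (k * d) hy0 hdpos.le (by positivity)
        push_cast
        rw [show y + (k + 1 : ℝ) * d = y + k * d + d by ring]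
        linarith
    set k := ⌈(z - y) / d⌉₊
    have hk1 : (z - y) / d ≤ k := Nat.le_ceil _
    have hk2 : (k : ℝ) < (z - y) / d + 1 := Nat.ceil_lt_add_one (div_nonneg (by linarith) hdpos.le)
    have hzk : z ≤ y + k * d := by
      have := (div_le_iff₀ hdpos).1 hk1; linarith
    have hz' : f (y + k * d) ≤ f z := hf hz (by simp only [mem_Ici]; positivity) hzk
    have hfac : (k : ℝ) ≤ ((z - y) / a + 1 / ((n : ℝ) + 1)) * (n + 1) := by
      refine hk2.le.trans (le_of_eq ?_)
      rw [hd]; field_simp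
    have hfd : 0 ≤ f y - f (y + d) :=
      sub_nonneg.2 (hf hy0 (by simp only [mem_Ici]; positivity) (by linarith))
    calc f y - f z ≤ k * (f y - f (y + d)) := by linarith [hright k]
      _ ≤ ((z - y) / a + 1 / ((n : ℝ) + 1)) * (n + 1) * (f y - f (y + d)) := by gcongr
      _ = ((z - y) / a + 1 / ((n : ℝ) + 1)) * ((n + 1) * (f y - f (y + d))) := by ring
      _ ≤ _ := by
        refine mul_le_mul_of_nonneg_left hleft ?_
        have : 0 ≤ (z - y) / a := div_nonneg (by linarith) hapos.le
        positivity
  have hlim : f y - f z ≤ (z - y) / a * (f x - f y) := by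
    refine ge_of_tendsto' (x := atTop) ?_ key
    have := ((tendsto_one_div_add_atTop_nhds_zero_nat (𝕜 := ℝ)).const_add ((z - y) / a)).mul_const
      (f x - f y)
    simpa using this
  rw [div_le_div_iff₀ hapos (by linarith)]
  have : (f y - f z) * a ≤ (z - y) * (f x - f y) := by
    rw [div_mul_eq_mul_div] at hlim
    exact (le_div_iff₀ hapos).1 hlim
  linarith

/-! ### Stationary reflected processes -/

/-- A process `W` with values in `[0, K]`, all of whose one-dimensional laws agree, and which
after each time `h` follows the reflection map driven by the path `Y h`. The paths `Y h` are the
increments after `h` of one process with stationary increments, and `Y h` is independent of `(W 0,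
W h)`. -/
structure IsStationaryReflection {Ω : Type*} [MeasurableSpace Ω] (K : ℝ)
    (Y : ℝ≥0 → Ω → ℝ≥0 → ℝ) (W : ℝ≥0 → Ω → ℝ) (P : Measure Ω) : Prop where
  measurable_driver : ∀ h, Measurable (Y h)
  driver_add : ∀ h t ω u, Y (h + t) ω u = Y h ω (t + u) - Y h ω t
  identDistrib_driver : ∀ h, IdentDistrib (Y h) (Y 0) P P
  mem_Icc : ∀ t, ∀ᵐ ω ∂P, W t ω ∈ Icc 0 K
  flow : ∀ h t, ∀ᵐ ω ∂P, W (h + t) ω = reflectionMap K t (W h ω) (Y h ω)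
  indep : ∀ h, IndepFun (fun ω => (W h ω, W 0 ω)) (Y h) P
  identDistrib : ∀ t, IdentDistrib (W t) (W 0) P P

lemma IsLevyProcess.isStationaryReflection {Ω : Type*} [MeasurableSpace Ω] {P : Measure Ω}
    [IsProbabilityMeasure P] {K : ℝ} (hK : 0 ≤ K) {X Q : ℝ → Ω → ℝ} (hX : IsLevyProcess X P)
    (hQ : ∀ᵐ ω ∂P, IsDoublyReflected K (fun t => X t ω) (fun t => Q t ω))
    (hindep : IndepFun (Q 0) (fun ω (t : Ici (0 : ℝ)) => X t ω - X 0 ω) P)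
    (hstat : ∀ t, 0 ≤ t → IdentDistrib (Q t) (Q 0) P P) :
    IsStationaryReflection K (incrementsAfter X) (fun t => Q t) P := by
  have hYm := measurable_incrementsAfter hX.measurable
  have hQ0m : AEMeasurable (Q 0) P := (hstat 0 le_rfl).aemeasurable_fst
  have hflow : ∀ h t : ℝ≥0, ∀ᵐ ω ∂P,
      Q ((h + t : ℝ≥0) : ℝ) ω = reflectionMap K t (Q h ω) (incrementsAfter X h ω) := fun h t => by
    filter_upwards [hQ, hX.cadlag] with ω h1 h2
    exact h1.eq_reflectionMap hK h2 h t
  have hind0 : IndepFun (Q 0) (incrementsAfter X 0) P := by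
    have := hindep.comp (φ := id) (ψ := fun (y : Ici (0 : ℝ) → ℝ) (u : ℝ≥0) => y ⟨u, u.2⟩)
      measurable_id (measurable_pi_lambda _ fun u => measurable_pi_apply _)
    refine this.congr .rfl (Eventually.of_forall fun ω => ?_)
    funext u
    simp [incrementsAfter]
  refine ⟨hYm, fun h t ω u => by simp [incrementsAfter, add_assoc],
    hX.identDistrib_incrementsAfter, fun t => hQ.mono fun ω h => h.1 t t.2, hflow, fun h => ?_,
    fun t => by simpa using hstat t t.2⟩
  -- `Q h` is a function of `Q 0` and of the path up to time `h`
  have e : incrementsAfter X h =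
      fun ω => (fun (y : ℝ≥0 → ℝ) u => y (h + u) - y h) (incrementsAfter X 0 ω) := by
    funext ω u; simp [incrementsAfter]
  have hpf := hX.indepFun_past_future h
  rw [e] at hpf
  have h1 := indepFun_prodMk_of_indepFun_comp (p := fun (y : ℝ≥0 → ℝ) u => y (min u h))
    (f := fun (y : ℝ≥0 → ℝ) u => y (h + u) - y h) hQ0m (hYm 0)
    (by fun_prop) (by fun_prop) hind0 hpf
  have h2 := h1.comp (φ := fun p : ℝ × (ℝ≥0 → ℝ) => (reflectionMap K h p.1 p.2, p.1))
    ((measurable_reflectionMap K h).prodMk measurable_fst) measurable_id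
  rw [e]
  refine h2.congr ?_ .rfl
  filter_upwards [hflow 0 h] with ω hω
  simp only [Function.comp_apply, reflectionMap_stopped]
  rw [zero_add] at hω
  rw [hω, NNReal.coe_zero]

namespace IsStationaryReflection

variable {Ω : Type*} [MeasurableSpace Ω] {P : Measure Ω} {K : ℝ}
  {Y : ℝ≥0 → Ω → ℝ≥0 → ℝ} {W : ℝ≥0 → Ω → ℝ}

lemma aemeasurable (hW : IsStationaryReflection K Y W P) (t : ℝ≥0) : AEMeasurable (W t) P :=
  (hW.identDistrib t).aemeasurable_fst

variable [IsProbabilityMeasure P]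

lemma memLp (hW : IsStationaryReflection K Y W P) (t : ℝ≥0) : MemLp (W t) 2 P :=
  memLp_of_bounded (hW.mem_Icc t) (hW.aemeasurable t).aestronglyMeasurable 2

lemma integrable_mul (hW : IsStationaryReflection K Y W P) (s t : ℝ≥0) :
    Integrable (fun ω => W s ω * W t ω) P :=
  (hW.memLp s).integrable_mul (hW.memLp t)

lemma integrable_sub_mul (hW : IsStationaryReflection K Y W P) (s t : ℝ≥0) :
    Integrable (fun ω => (W s ω - W 0 ω) * W t ω) P :=
  ((hW.memLp s).sub (hW.memLp 0)).integrable_mul (hW.memLp t)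

/-- Stationarity of the second moments: `(W h, Y h)` and `(W 0, Y 0)` have the same law. -/
lemma integral_mul_shift (hW : IsStationaryReflection K Y W P) (h t : ℝ≥0) :
    ∫ ω, W h ω * W (h + t) ω ∂P = ∫ ω, W 0 ω * W t ω ∂P := by
  have hlaw : IdentDistrib (fun ω => (W h ω, Y h ω)) (fun ω => (W 0 ω, Y 0 ω)) P P := by
    have hm : ∀ a, AEMeasurable (Y a) P := fun a => (hW.measurable_driver a).aemeasurable
    have hi : ∀ a, IndepFun (W a) (Y a) P := fun a =>
      (hW.indep a).comp measurable_fst measurable_id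
    refine ⟨(hW.aemeasurable h).prodMk (hm h), (hW.aemeasurable 0).prodMk (hm 0), ?_⟩
    rw [(indepFun_iff_map_prod_eq_prod_map_map (hW.aemeasurable h) (hm h)).1 (hi h),
      (indepFun_iff_map_prod_eq_prod_map_map (hW.aemeasurable 0) (hm 0)).1 (hi 0),
      (hW.identDistrib h).map_eq, (hW.identDistrib_driver h).map_eq]
  have e : ∀ a, ∫ ω, W a ω * W (a + t) ω ∂P =
      ∫ ω, W a ω * reflectionMap K t (W a ω) (Y a ω) ∂P := fun a =>
    integral_congr_ae (by filter_upwards [hW.flow a t] with ω hω; rw [hω])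
  have e0 := e 0
  rw [zero_add] at e0
  rw [e, e0]
  exact (hlaw.comp (u := fun p : ℝ × (ℝ≥0 → ℝ) => p.1 * reflectionMap K t p.1 p.2)
    (measurable_fst.mul (measurable_reflectionMap K t))).integral_eq

lemma integral_increment_mul_nonneg (hW : IsStationaryReflection K Y W P) (h : ℝ≥0)
    {H : ℝ × (ℝ≥0 → ℝ) → ℝ} {C : ℝ} (hH : Measurable H) (hHC : ∀ p, |H p| ≤ C)
    (hHm : ∀ y, Monotone fun a => H (a, y)) :
    0 ≤ ∫ ω, (W h ω - W 0 ω) * H (W h ω, Y h ω) ∂P :=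
  integral_sub_mul_nonneg_of_indepFun (hW.aemeasurable h) (hW.aemeasurable 0)
    (hW.measurable_driver h) hH (hW.mem_Icc h) (hW.mem_Icc 0) (hW.indep h) hHC hHm
    fun _ hg hgC => integral_sub_mul_nonneg_of_identDistrib (hW.identDistrib h) (hW.mem_Icc h)
      (hW.mem_Icc 0) hg hgC

lemma integral_mul_antitone (hW : IsStationaryReflection K Y W P) (hK : 0 ≤ K) (h t : ℝ≥0) :
    ∫ ω, W 0 ω * W (h + t) ω ∂P ≤ ∫ ω, W 0 ω * W t ω ∂P := by
  have h0 := hW.integral_increment_mul_nonneg h (measurable_reflectionMap K t)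
    (fun p => abs_reflectionMap_le hK t p.1 p.2) fun y => reflectionMap_mono hK t y
  rw [← hW.integral_mul_shift h t, ← sub_nonneg,
    ← integral_sub (hW.integrable_mul _ _) (hW.integrable_mul _ _)]
  refine h0.trans_eq (integral_congr_ae ?_)
  filter_upwards [hW.flow h t] with ω hω
  rw [← hω]; ring

/-- The decrements of `t ↦ E[W 0 * W t]` over a fixed length `h` are non-increasing: the
difference of the flows at times `t` and `t + s` is non-decreasing in the starting level, because
the reflection map from `t` to `t + s` is `1`-Lipschitz. -/
lemma integral_mul_second_difference (hW : IsStationaryReflection K Y W P) (hK : 0 ≤ K)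
    (h t s : ℝ≥0) :
    ∫ ω, W 0 ω * W (t + s) ω ∂P - ∫ ω, W 0 ω * W (h + (t + s)) ω ∂P ≤
      ∫ ω, W 0 ω * W t ω ∂P - ∫ ω, W 0 ω * W (h + t) ω ∂P := by
  let F : ℝ × (ℝ≥0 → ℝ) → ℝ × (ℝ≥0 → ℝ) := fun p =>
    (reflectionMap K t p.1 p.2, fun u => p.2 (t + u) - p.2 t)
  have hF : Measurable F := (measurable_reflectionMap K t).prodMk (by fun_prop)
  let H : ℝ × (ℝ≥0 → ℝ) → ℝ := fun p =>
    reflectionMap K t p.1 p.2 - reflectionMap K s (F p).1 (F p).2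
  have hH : Measurable H :=
    (measurable_reflectionMap K t).sub ((measurable_reflectionMap K s).comp hF)
  have hHC : ∀ p, |H p| ≤ K := fun p => by
    have h1 := reflectionMap_mem_Icc hK t p.1 p.2
    have h2 := reflectionMap_mem_Icc hK s (F p).1 (F p).2
    exact abs_le.2 ⟨by linarith [h1.1, h2.2], by linarith [h1.2, h2.1]⟩
  have hHm : ∀ y, Monotone fun a => H (a, y) := fun y a b hab => by
    have := reflectionMap_le_add hK s (fun u => y (t + u) - y t) (reflectionMap_mono hK t y hab)
    dsimp only [H, F] at this ⊢
    linarith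
  have h0 := hW.integral_increment_mul_nonneg h hH hHC hHm
  rw [← hW.integral_mul_shift h t, ← hW.integral_mul_shift h (t + s)]
  have e : ∀ r, ∫ ω, (W h ω - W 0 ω) * W (h + r) ω ∂P =
      ∫ ω, W h ω * W (h + r) ω ∂P - ∫ ω, W 0 ω * W (h + r) ω ∂P := fun r => by
    rw [← integral_sub (hW.integrable_mul h (h + r)) (hW.integrable_mul 0 (h + r))]
    exact integral_congr_ae (Eventually.of_forall fun ω => by ring)
  rw [← e t, ← e (t + s), ← sub_nonneg,
    ← integral_sub (hW.integrable_sub_mul h (h + t)) (hW.integrable_sub_mul h (h + (t + s)))]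
  have hcongr : ∀ᵐ ω ∂P, (W h ω - W 0 ω) * H (W h ω, Y h ω) =
      (W h ω - W 0 ω) * W (h + t) ω - (W h ω - W 0 ω) * W (h + (t + s)) ω := by
    filter_upwards [hW.flow h t, hW.flow (h + t) s] with ω h1 h2
    have hsh : (fun u => Y h ω (t + u) - Y h ω t) = Y (h + t) ω :=
      funext fun u => (hW.driver_add h t ω u).symm
    dsimp only [H, F]
    rw [← h1, hsh, ← h2, ← add_assoc, mul_sub]
  exact h0.trans_eq (integral_congr_ae hcongr)

lemma sq_integral_le_integral_mul (hW : IsStationaryReflection K Y W P) (hK : 0 ≤ K)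
    (t : ℝ≥0) : (∫ ω, W 0 ω ∂P) * ∫ ω, W t ω ∂P ≤ ∫ ω, W 0 ω * W t ω ∂P := by
  set m := ∫ ω, W 0 ω ∂P with hm
  have hi : ∀ s, Integrable (W s) P := fun s =>
    Integrable.of_mem_Icc 0 K (hW.aemeasurable s) (hW.mem_Icc s)
  have hmK : m ∈ Icc 0 K := by
    refine ⟨integral_nonneg_of_ae ((hW.mem_Icc 0).mono fun ω h => h.1), ?_⟩
    simpa using integral_mono_ae (hi 0) (integrable_const K) ((hW.mem_Icc 0).mono fun ω h => h.2)
  have h0 := integral_sub_mul_nonneg_of_indepFun (B := fun _ => m) (hW.aemeasurable 0)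
    aemeasurable_const (hW.measurable_driver 0) (measurable_reflectionMap K t) (hW.mem_Icc 0)
    (Eventually.of_forall fun _ => hmK)
    ((hW.indep 0).comp (φ := fun p => (p.1, m)) (by fun_prop) measurable_id)
    (fun p => abs_reflectionMap_le hK t p.1 p.2) (fun y => reflectionMap_mono hK t y)
    (fun g hg hgC => integral_sub_integral_mul_nonneg (hW.aemeasurable 0) (hW.mem_Icc 0) hg hgC)
  rw [← integral_const_mul, ← sub_nonneg,
    ← integral_sub (hW.integrable_mul _ _) ((hi t).const_mul m)]
  refine h0.trans_eq (integral_congr_ae ?_)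
  filter_upwards [hW.flow 0 t] with ω hω
  rw [zero_add] at hω
  rw [← hω]; ring

end IsStationaryReflection

theorem theorem2 {Ω : Type*} [MeasurableSpace Ω] (P : Measure Ω) [IsProbabilityMeasure P]
    (K : ℝ) (hK : 0 < K) (X Q : ℝ → Ω → ℝ)
    -- the driving process is a Lévy process
    (hX : IsLevyProcess X P)
    -- the workload is the driving process reflected at `0` and at `K`
    (hQ : ∀ᵐ ω ∂P, IsDoublyReflected K (fun t => X t ω) (fun t => Q t ω))
    -- the workload at time `0` is independent of the increments of the driving process after `0`
    (hindep : IndepFun (Q 0) (fun ω (t : Ici (0 : ℝ)) => X t ω - X 0 ω) P)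
    -- the workload is in stationarity at time `0`
    (hstat : ∀ t, 0 ≤ t → IdentDistrib (Q t) (Q 0) P P)
    -- the workload is not almost surely constant, so that `r` is well defined
    (hvar : 0 < Var[Q 0; P]) :
    (∀ t, 0 ≤ t → 0 ≤ workloadCorrelation Q P t) ∧
      AntitoneOn (workloadCorrelation Q P) (Ici 0) ∧
      ConvexOn ℝ (Ici 0) (workloadCorrelation Q P) := by
  have hW := hX.isStationaryReflection hK.le hQ hindep hstat
  set m := ∫ ω, Q 0 ω ∂P with hm
  set v := Var[Q 0; P]
  have hmean : ∀ t : ℝ≥0, ∫ ω, Q t ω ∂P = m := fun t => (hstat t t.2).integral_eq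
  have hr : ∀ t : ℝ≥0,
      workloadCorrelation Q P t = (∫ ω, Q (0 : ℝ≥0) ω * Q t ω ∂P - m * m) / v := fun t => by
    have hv : Var[Q t; P] = v := (hstat t t.2).variance_eq
    have h0 : MemLp (Q 0) 2 P := hW.memLp 0
    rw [workloadCorrelation, hv, Real.sqrt_mul_self hvar.le, covariance_eq_sub h0 (hW.memLp t),
      hmean t]
    rfl
  have hanti : AntitoneOn (workloadCorrelation Q P) (Ici 0) := fun s hs t ht hst => by
    lift s to ℝ≥0 using hs
    lift t to ℝ≥0 using ht
    have := hW.integral_mul_antitone hK.le (t - s) s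
    rw [tsub_add_cancel_of_le (NNReal.coe_le_coe.1 hst)] at this
    rw [hr, hr]
    gcongr
  refine ⟨fun t ht => ?_, hanti, convexOn_Ici_of_antitoneOn_of_second_difference hanti
    fun t d s ht hd hs => ?_⟩
  · lift t to ℝ≥0 using ht
    have := hW.sq_integral_le_integral_mul hK.le t
    rw [hmean t, hmean 0] at this
    rw [hr]
    exact div_nonneg (sub_nonneg.2 this) hvar.le
  · lift t to ℝ≥0 using ht
    lift d to ℝ≥0 using hd
    lift s to ℝ≥0 using hs
    have := hW.integral_mul_second_difference hK.le d t s
    rw [add_comm d t, add_comm d (t + s)] at this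
    simp only [← NNReal.coe_add, hr]
    rw [← sub_div, ← sub_div]
    exact div_le_div_of_nonneg_right (by linarith) hvar.le
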